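/- Let $\mathscr{X}$ be a (right) Hilbert $C^*$-module over a unital $C^*$-algebra $\mathscr{A}$, with $\mathscr{A}$-valued inner product $\langle\cdot,\cdot\rangle$ that is conjugate linear in the first variable and linear in the second, and with norm $\|x\|=\|\langle x,x\rangle\|^{1/2}$. Let $\mathcal{L}(\mathscr{X})$ be the unital $C^*$-algebra of adjointable operators on $\mathscr{X}$. Let $J\subseteq\mathbb{R}$ be an interval with $0\in J$, and let $f:J\to\mathbb{R}$ be operator convex, that is, $f$ is continuous and $$f((1-\lambda)A+\lambda B)\le(1-\lambda)f(A)+\lambda f(B)$$ for all $\lambda\in[0,1]$ and all bounded self-adjoint operators $A,B$ on a complex Hilbert space whose spectra are contained in $J$. Suppose that $f(0)\le 0$. Let $S,T_1,\dots,T_n,R_1,\dots,R_n\in\mathcal{L}(\mathscr{X})$, where $S$ and all $T_i$ are self-adjoint, and suppose that the spectra of $S-\sum_{i=1}^nR_i^*T_iR_i$ and of each $T_i$ are contained in $J$. Let $x\in\mathscr{X}$ with $\|x\|\le1$ and put $k_n=\bigl(1+\sum_{i=1}^n\|R_ix\|^2\bigr)^{-1}$. Then the spectrum of the self-adjoint element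 $k_n\langle x,Sx\rangle$ of $\mathscr{A}$ is contained in $J$ (so that $f(k_n\langle x,Sx\rangle)$ is defined), and, in the order of $\mathscr{A}$, $$\Bigl\langle x,\Bigl[f\Bigl(S-\sum_{i=1}^nR_i^*T_iR_i\Bigr)+\sum_{i=1}^nR_i^*f(T_i)R_i\Bigr]x\Bigr\rangle\ \ge\ k_n^{-1}\,f\bigl(k_n\langle x,Sx\rangle\bigr).$$ Here $f$ of a self-adjoint element with spectrum in $J$ is given by the continuous functional calculus. -/

import Mathlib

universe u v w

open MulOpposite

/-- Operator convexity of a real function on a set `J ⊆ ℝ` (an interval in the applications):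
`f` is continuous on `J`, and `f ((1 - c) S + c T) ≤ (1 - c) f(S) + c f(T)` for all bounded
self-adjoint operators `S`, `T` on a complex Hilbert space `H` whose spectra lie in `J`.
Here `f(S)` is the continuous functional calculus and `≤` is the Loewner order. -/
def OperatorConvexOn (J : Set ℝ) (f : ℝ → ℝ) : Prop :=
  ContinuousOn f J ∧
    ∀ (H : Type w) [NormedAddCommGroup H] [InnerProductSpace ℂ H] [CompleteSpace H]
      (S T : H →L[ℂ] H), IsSelfAdjoint S → IsSelfAdjoint T →
      spectrum ℝ S ⊆ J → spectrum ℝ T ⊆ J →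
      ∀ c ∈ Set.Icc (0 : ℝ) 1,
        cfc f ((1 - c) • S + c • T) ≤ (1 - c) • cfc f S + c • cfc f T

/-!
A right Hilbert `A`-module is a complete `CStarModule Aᵐᵒᵖ X`: Mathlib's class asks for
`⟪x, a • y⟫ = a * ⟪x, y⟫`, so over the opposite algebra, with `y a = op a • y`, it is the usual
axiom `⟨x, y a⟩ = ⟨x, y⟩ a` of a right module (see `HilbertModule.ip_mul_right`).
-/

set_option linter.unusedSectionVars false

namespace HilbertModule

section

variable (A : Type u) {X : Type v} [CStarAlgebra A] [PartialOrder A] [StarOrderedRing A]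
  [NormedAddCommGroup X] [NormedSpace ℂ X] [Module Aᵐᵒᵖ X] [CStarModule Aᵐᵒᵖ X]

/-- The `A`-valued inner product `⟨x, y⟩` of a right Hilbert `A`-module, conjugate linear in the
first variable and linear in the second. -/
def ip (x y : X) : A := unop (inner Aᵐᵒᵖ x y)

theorem ip_mul_right (x y : X) (a : A) : ip A x (op a • y) = ip A x y * a := by
  simp [ip]

theorem ip_add_right (x y z : X) : ip A x (y + z) = ip A x y + ip A x z := by
  simp [ip]

theorem ip_smul_right (c : ℂ) (x y : X) : ip A x (c • y) = c • ip A x y := by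
  simp [ip]

theorem star_ip (x y : X) : star (ip A x y) = ip A y x := by
  simp [ip, ← unop_star]

theorem ip_add_left (x y z : X) : ip A (x + y) z = ip A x z + ip A y z := by
  rw [← star_ip, ip_add_right, star_add, star_ip, star_ip]

theorem ip_smul_left (c : ℂ) (x y : X) : ip A (c • x) y = star c • ip A x y := by
  rw [← star_ip, ip_smul_right, star_smul, star_ip]

theorem ip_self_nonneg (x : X) : 0 ≤ ip A x x :=
  CStarModule.inner_self_nonneg (A := Aᵐᵒᵖ) (x := x)

theorem norm_sq_eq (x : X) : ‖x‖ ^ 2 = ‖ip A x x‖ :=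
  CStarModule.norm_sq_eq Aᵐᵒᵖ

theorem norm_ip_le (x y : X) : ‖ip A x y‖ ≤ ‖x‖ * ‖y‖ :=
  CStarModule.norm_inner_le (A := Aᵐᵒᵖ) X

theorem continuous_ip : Continuous fun p : X × X => ip A p.1 p.2 :=
  continuous_unop.comp (CStarModule.continuous_inner (A := Aᵐᵒᵖ))

theorem ext_ip {x y : X} (h : ∀ z, ip A z x = ip A z y) : x = y := by
  have h0 : ip A (x - y) (x - y) = 0 := by
    have h1 : ip A (x - y) (x - y) + ip A (x - y) y = ip A (x - y) x := by
      rw [← ip_add_right, sub_add_cancel]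
    rw [h] at h1
    simpa using h1
  have h2 := norm_sq_eq A (x - y)
  rw [h0] at h2
  have h3 : ‖x - y‖ = 0 := by simpa using h2
  exact sub_eq_zero.mp (norm_eq_zero.mp h3)

/-- `S` is an adjoint of the mapping `T : X → X`. -/
def IsAdjointPair (T S : X → X) : Prop := ∀ x y, ip A (T x) y = ip A x (S y)

/-- A mapping `T : X → X` is adjointable if it has an adjoint. -/
def IsAdjointable (T : X → X) : Prop := ∃ S : X → X, IsAdjointPair A T S

variable {A}

theorem IsAdjointPair.symm {T S : X → X} (h : IsAdjointPair A T S) : IsAdjointPair A S T := by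
  intro x y
  rw [← star_ip, ← h, star_ip]

/-- Adjointable mappings are automatically linear and bounded. -/
theorem IsAdjointPair.exists_clm [CompleteSpace X] {T S : X → X} (h : IsAdjointPair A T S) :
    ∃ T' : X →L[ℂ] X, ⇑T' = T := by
  have h' := h.symm
  let L : X →ₗ[ℂ] X :=
    { toFun := T
      map_add' := fun x y => ext_ip A fun z => by
        rw [← h', ip_add_right, ip_add_right, h', h']
      map_smul' := fun c x => ext_ip A fun z => by
        rw [← h', RingHom.id_apply, ip_smul_right, ip_smul_right, h'] }
  refine ⟨⟨L, L.continuous_of_seq_closed_graph ?_⟩, rfl⟩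
  intro s x y hs hT
  refine ext_ip A fun z => ?_
  have e1 : Filter.Tendsto (fun n => ip A z (L (s n))) Filter.atTop (nhds (ip A z y)) :=
    ((continuous_ip A).tendsto (z, y)).comp (tendsto_const_nhds.prodMk_nhds hT)
  have e2 : Filter.Tendsto (fun n => ip A (S z) (s n)) Filter.atTop (nhds (ip A (S z) x)) :=
    ((continuous_ip A).tendsto (S z, x)).comp (tendsto_const_nhds.prodMk_nhds hs)
  have e3 : (fun n => ip A z (L (s n))) = fun n => ip A (S z) (s n) :=
    funext fun n => (h' z (s n)).symm
  rw [e3] at e1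
  rw [tendsto_nhds_unique e1 e2]
  exact h' z x

theorem IsAdjointPair.norm_sq_apply_le {T S : X →L[ℂ] X} (h : IsAdjointPair A T S) (x : X) :
    ‖T x‖ ^ 2 ≤ ‖S * T‖ * ‖x‖ ^ 2 := by
  rw [norm_sq_eq A, h]
  calc ‖ip A x (S (T x))‖ ≤ ‖x‖ * ‖(S * T) x‖ := norm_ip_le A _ _
    _ ≤ ‖x‖ * (‖S * T‖ * ‖x‖) := by gcongr; exact (S * T).le_opNorm x
    _ = ‖S * T‖ * ‖x‖ ^ 2 := by ring

theorem IsAdjointPair.norm_sq_le {T S : X →L[ℂ] X} (h : IsAdjointPair A T S) :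
    ‖T‖ ^ 2 ≤ ‖S * T‖ := by
  have h1 : ‖T‖ ≤ √‖S * T‖ := by
    refine T.opNorm_le_bound (Real.sqrt_nonneg _) fun x => ?_
    refine le_of_sq_le_sq ?_ (by positivity)
    rw [mul_pow, Real.sq_sqrt (norm_nonneg _)]
    exact h.norm_sq_apply_le x
  calc ‖T‖ ^ 2 ≤ √‖S * T‖ ^ 2 := by gcongr
    _ = ‖S * T‖ := Real.sq_sqrt (norm_nonneg _)

theorem IsAdjointPair.norm_le {T S : X →L[ℂ] X} (h : IsAdjointPair A T S) : ‖T‖ ≤ ‖S‖ := by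
  by_contra! hlt
  have h1 := h.norm_sq_le.trans (norm_mul_le S T)
  nlinarith [norm_nonneg S, norm_nonneg T]

theorem IsAdjointPair.sub {T S T' S' : X →L[ℂ] X} (h : IsAdjointPair A T S)
    (h' : IsAdjointPair A T' S') : IsAdjointPair A (T - T' : X →L[ℂ] X) (S - S' : X →L[ℂ] X) := by
  intro x y
  have e1 : ip A ((T - T') x) y + ip A (T' x) y = ip A (T x) y := by
    rw [← ip_add_left]; simp
  have e2 : ip A x ((S - S') y) + ip A x (S' y) = ip A x (S y) := by
    rw [← ip_add_right]; simp
  rw [h, h', ← e2] at e1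
  exact add_right_cancel e1

end

section

variable (A : Type u) (X : Type v) [CStarAlgebra A] [PartialOrder A] [StarOrderedRing A]
  [NormedAddCommGroup X] [NormedSpace ℂ X] [Module Aᵐᵒᵖ X] [CStarModule Aᵐᵒᵖ X]

/-- The adjointable mappings, as a subalgebra of the bounded operators on `X`
(by `IsAdjointPair.exists_clm` nothing is lost by starting from bounded operators). -/
def adjointableSubalgebra : Subalgebra ℂ (X →L[ℂ] X) where
  carrier := {T | IsAdjointable A T}
  mul_mem' := by
    rintro T T' ⟨S, hS⟩ ⟨S', hS'⟩
    refine ⟨S' ∘ S, fun x y => ?_⟩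
    exact (hS (T' x) y).trans (hS' x (S y))
  add_mem' := by
    rintro T T' ⟨S, hS⟩ ⟨S', hS'⟩
    refine ⟨S + S', fun x y => ?_⟩
    simp only [add_apply, Pi.add_apply, ip_add_left, ip_add_right]
    rw [hS, hS']
  algebraMap_mem' := by
    intro c
    refine ⟨fun y => star c • y, fun x y => ?_⟩
    rw [Algebra.algebraMap_eq_smul_one, ip_smul_right, smul_apply,
      ip_smul_left, one_apply_eq_self]

/-- The algebra `𝓛(X)` of adjointable operators on the right Hilbert `A`-module `X`, with the
operator norm. -/
abbrev Adjointable : Type v := adjointableSubalgebra A X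

variable {A X}

/-- The evaluation `T x`. -/
instance : CoeFun (Adjointable A X) (fun _ => X → X) := ⟨fun T => (T : X →L[ℂ] X)⟩

variable [CompleteSpace X]

theorem Adjointable.exists_adjoint (T : Adjointable A X) :
    ∃ S : Adjointable A X, IsAdjointPair A T S := by
  obtain ⟨T, S, hS⟩ := T
  obtain ⟨S', rfl⟩ := hS.symm.exists_clm
  exact ⟨⟨S', T, hS.symm⟩, hS⟩

/-- The adjoint `T*`. -/
noncomputable instance : Star (Adjointable A X) := ⟨fun T => T.exists_adjoint.choose⟩

theorem Adjointable.ip_apply_left (T : Adjointable A X) : IsAdjointPair A T (star T : Adjointable A X) :=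
  T.exists_adjoint.choose_spec

theorem Adjointable.star_eq {T S : Adjointable A X} (h : IsAdjointPair A T S) : star T = S := by
  refine Subtype.ext (ContinuousLinearMap.ext fun y => ext_ip A fun z => ?_)
  rw [← T.ip_apply_left, h]

noncomputable instance : StarRing (Adjointable A X) where
  star_involutive T := Adjointable.star_eq T.ip_apply_left.symm
  star_mul T T' := Adjointable.star_eq fun x y =>
    (T.ip_apply_left (T' x) y).trans (T'.ip_apply_left x (star T y))
  star_add T T' := Adjointable.star_eq fun x y => by
    change ip A (T x + T' x) y = ip A x (star T y + star T' y)
    rw [ip_add_left, ip_add_right, T.ip_apply_left, T'.ip_apply_left]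

instance : StarModule ℂ (Adjointable A X) where
  star_smul c T := Adjointable.star_eq fun x y => by
    change ip A (c • T x) y = ip A x (star c • star T y)
    rw [ip_smul_left, ip_smul_right, T.ip_apply_left]

instance : CStarRing (Adjointable A X) where
  norm_mul_self_le T := by
    have h := T.ip_apply_left.norm_sq_le
    rw [pow_two] at h
    exact h

instance : CompleteSpace (Adjointable A X) := by
  suffices h : IsClosed (adjointableSubalgebra A X : Set (X →L[ℂ] X)) from h.completeSpace_coe
  refine isClosed_of_closure_subset fun T hT => ?_
  obtain ⟨s, hs, hlim⟩ := mem_closure_iff_seq_limit.mp hT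
  let t : ℕ → Adjointable A X := fun n => ⟨s n, hs n⟩
  let r : ℕ → (X →L[ℂ] X) := fun n => (star (t n) : Adjointable A X)
  have hr : CauchySeq r := by
    have hc := hlim.cauchySeq
    rw [Metric.cauchySeq_iff] at hc ⊢
    intro ε hε
    obtain ⟨N, hN⟩ := hc ε hε
    refine ⟨N, fun m hm n hn => lt_of_le_of_lt ?_ (hN m hm n hn)⟩
    rw [dist_eq_norm, dist_eq_norm]
    exact ((t m).ip_apply_left.sub (t n).ip_apply_left).symm.norm_le
  obtain ⟨S, hS⟩ := cauchySeq_tendsto_of_complete hr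
  refine ⟨S, fun x y => ?_⟩
  have e1 : Filter.Tendsto (fun n => ip A (s n x) y) Filter.atTop (nhds (ip A (T x) y)) :=
    ((continuous_ip A).tendsto (T x, y)).comp
      (((ContinuousLinearMap.apply ℂ X x).continuous.tendsto T |>.comp hlim).prodMk_nhds
        tendsto_const_nhds)
  have e2 : Filter.Tendsto (fun n => ip A x (r n y)) Filter.atTop (nhds (ip A x (S y))) :=
    ((continuous_ip A).tendsto (x, S y)).comp
      (tendsto_const_nhds.prodMk_nhds
        ((ContinuousLinearMap.apply ℂ X y).continuous.tendsto S |>.comp hS))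
  have e3 : (fun n => ip A (s n x) y) = fun n => ip A x (r n y) :=
    funext fun n => (t n).ip_apply_left x y
  rw [e3] at e1
  exact tendsto_nhds_unique e1 e2

/-- `𝓛(X)` is a unital C⋆-algebra; this makes the continuous functional calculus available. -/
noncomputable instance : CStarAlgebra (Adjointable A X) where

end

end HilbertModule

/-! The theorem is Jensen's operator inequality for one column. Let `D` be the diagonal operator
with entries `S - ∑ R i* T i R i`, `T 1`, …, `T n`, and `y` the column `√k (x, R 1 x, …, R n x)`. In
`⟨y, D y⟩` the terms with `T i` cancel and `k ⟨x, S x⟩` remains, while `‖x‖ ≤ 1` and the choice of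
`k` give `⟨y, y⟩ ≤ 1`. Jensen's inequality `f(⟨y, D y⟩) ≤ ⟨y, f(D) y⟩`, divided by `k`, is the
claim.

If `⟨y, y⟩ = 1`, the symmetry `U = 2 y⟨y, ·⟩ - 1` is unitary and `B = (D + U D U) / 2` satisfies `B
y = y a` with `a = ⟨y, D y⟩`. Hence `f(a) = ⟨y, f(B) y⟩`, and operator convexity bounds this by `⟨y,
f(D) y⟩` (`cfc_ip_apply_le_of_ip_self_eq_one`). If only `⟨y, y⟩ ≤ 1`, an extra coordinate in `A`
completes `y` to a unit vector; `D` is `0` there, which costs a term with `f 0 ≤ 0`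
(`cfc_sum_ip_apply_le`). Convexity, assumed for Hilbert space operators, reaches `𝓛(X)` through GNS
representations (`cfc_convexCombination_le`). -/

/-! ### Operator convexity and functional calculus in abstract C⋆-algebras. -/

section CStarAlgebra

open scoped ComplexOrder

/-- A self-adjoint element on which all positive functionals are nonnegative is nonnegative. -/
theorem CStarAlgebra.nonneg_of_forall_positiveLinearMap {A : Type u} [CStarAlgebra A]
    [PartialOrder A] [StarOrderedRing A] {a : A} (ha : IsSelfAdjoint a)
    (h : ∀ φ : A →ₚ[ℂ] ℂ, 0 ≤ φ a) : 0 ≤ a := by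
  by_contra hneg
  have hconv : Convex ℝ {b : A | 0 ≤ b} := fun x hx y hy s t hs ht _ =>
    add_nonneg (smul_nonneg hs hx) (smul_nonneg ht hy)
  obtain ⟨g, r, hga, hgr⟩ :=
    geometric_hahn_banach_point_closed hconv CStarAlgebra.isClosed_nonneg hneg
  have hr : r < 0 := by simpa using hgr 0 le_rfl
  -- A negative value on the cone could be rescaled to equal `r`, against the strict bound `r < g`.
  have hg : ∀ b : A, 0 ≤ b → 0 ≤ g b := by
    intro b hb
    by_contra! hlt
    have h1 := hgr ((r / g b) • b) (smul_nonneg (div_nonneg_of_nonpos hr.le hlt.le) hb)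
    rw [map_smul, smul_eq_mul, div_mul_cancel₀ _ hlt.ne] at h1
    exact lt_irrefl _ h1
  -- The real functional `g ∘ Re` is extended complex linearly; on self-adjoint elements the
  -- extension is `g` again.
  let g' : Module.Dual ℝ A :=
    g.toLinearMap ∘ₗ (selfAdjoint.submodule ℝ A).subtype ∘ₗ realPart
  have key : ∀ b : A, IsSelfAdjoint b → g'.extendRCLike (𝕜 := ℂ) b = (g b : ℂ) := by
    intro b hb
    have h1 : g' b = g b := by
      change g ((realPart b : selfAdjoint A) : A) = g b
      rw [hb.coe_realPart]
    have h2 : g' (Complex.I • b) = 0 := by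
      change g ((realPart (Complex.I • b) : selfAdjoint A) : A) = 0
      rw [realPart_I_smul, hb.imaginaryPart]
      simp
    rw [Module.Dual.extendRCLike_apply]
    simp [h1, h2]
  let φ : A →ₚ[ℂ] ℂ := PositiveLinearMap.mk₀ (g'.extendRCLike (𝕜 := ℂ)) fun b hb => by
    rw [key b hb.isSelfAdjoint]
    exact_mod_cast hg b hb
  have h1 : 0 ≤ φ a := h φ
  have h2 : φ a = (g a : ℂ) := key a ha
  rw [h2] at h1
  have h3 : 0 ≤ g a := by exact_mod_cast h1
  linarith

/-- An element that is nonnegative in all Gelfand–Naimark–Segal representations is nonnegative. -/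
theorem CStarAlgebra.nonneg_of_forall_gns {A : Type u} [CStarAlgebra A]
    [PartialOrder A] [StarOrderedRing A] {a : A} (ha : IsSelfAdjoint a)
    (h : ∀ φ : A →ₚ[ℂ] ℂ, 0 ≤ φ.gnsStarAlgHom a) : 0 ≤ a := by
  refine CStarAlgebra.nonneg_of_forall_positiveLinearMap ha fun φ => ?_
  -- The class of `1` is the cyclic vector, whose vector state is `φ`.
  have h1 := ((ContinuousLinearMap.nonneg_iff_isPositive _).mp (h φ)).inner_nonneg_right
    (φ.toPreGNS 1 : φ.GNS)
  simpa [PositiveLinearMap.gnsStarAlgHom_apply, UniformSpace.Completion.inner_coe,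
    PositiveLinearMap.preGNS_inner_def] using h1

/-- Convexity of the set of self-adjoint elements with spectrum in an interval. -/
theorem spectrum_convexCombination_subset {A : Type u} [CStarAlgebra A] [PartialOrder A]
    [StarOrderedRing A] {a b : A} (ha : IsSelfAdjoint a) (hb : IsSelfAdjoint b) {m M : ℝ}
    (haJ : spectrum ℝ a ⊆ Set.Icc m M) (hbJ : spectrum ℝ b ⊆ Set.Icc m M) {c : ℝ}
    (hc : c ∈ Set.Icc (0 : ℝ) 1) :
    spectrum ℝ ((1 - c) • a + c • b) ⊆ Set.Icc m M := by
  have hc' : 0 ≤ 1 - c := sub_nonneg.mpr hc.2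
  have hab : IsSelfAdjoint ((1 - c) • a + c • b) :=
    ((IsSelfAdjoint.all _).smul ha).add ((IsSelfAdjoint.all _).smul hb)
  have split : ∀ r : ℝ, algebraMap ℝ A r = (1 - c) • algebraMap ℝ A r + c • algebraMap ℝ A r := by
    intro r
    rw [← add_smul, sub_add_cancel, one_smul]
  -- For self-adjoint elements, spectrum in `[m, M]` amounts to the order bounds `m ≤ · ≤ M`, which
  -- pass to convex combinations.
  have h1 : algebraMap ℝ A m ≤ (1 - c) • a + c • b := by
    rw [split]
    gcongr
    · exact (algebraMap_le_iff_le_spectrum ha).mpr fun x hx => (haJ hx).1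
    · exact hc.1
    · exact (algebraMap_le_iff_le_spectrum hb).mpr fun x hx => (hbJ hx).1
  have h2 : (1 - c) • a + c • b ≤ algebraMap ℝ A M := by
    rw [split]
    gcongr
    · exact (le_algebraMap_iff_spectrum_le ha).mpr fun x hx => (haJ hx).2
    · exact hc.1
    · exact (le_algebraMap_iff_spectrum_le hb).mpr fun x hx => (hbJ hx).2
  exact fun x hx => ⟨(algebraMap_le_iff_le_spectrum hab).mp h1 x hx,
    (le_algebraMap_iff_spectrum_le hab).mp h2 x hx⟩

/-- Operator convexity passes from operators on Hilbert spaces to abstract C⋆-algebras. -/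
theorem OperatorConvexOn.cfc_convexCombination_le {J : Set ℝ} {f : ℝ → ℝ}
    (hf : OperatorConvexOn.{w} J f) {A : Type w} [CStarAlgebra A] [PartialOrder A]
    [StarOrderedRing A] {a b : A} (ha : IsSelfAdjoint a) (hb : IsSelfAdjoint b) {m M : ℝ}
    (hmM : Set.Icc m M ⊆ J) (haJ : spectrum ℝ a ⊆ Set.Icc m M)
    (hbJ : spectrum ℝ b ⊆ Set.Icc m M) {c : ℝ} (hc : c ∈ Set.Icc (0 : ℝ) 1) :
    cfc f ((1 - c) • a + c • b) ≤ (1 - c) • cfc f a + c • cfc f b := by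
  have hab : IsSelfAdjoint ((1 - c) • a + c • b) :=
    ((IsSelfAdjoint.all _).smul ha).add ((IsSelfAdjoint.all _).smul hb)
  rw [← sub_nonneg]
  refine CStarAlgebra.nonneg_of_forall_gns ?_ fun φ => ?_
  · exact (((IsSelfAdjoint.all _).smul (cfc_predicate f a)).add
      ((IsSelfAdjoint.all _).smul (cfc_predicate f b))).sub (cfc_predicate f _)
  · set π := φ.gnsStarAlgHom
    have hπ : Continuous π := by fun_prop
    have hmap : ∀ d : A, IsSelfAdjoint d → spectrum ℝ d ⊆ Set.Icc m M →
        π (cfc f d) = cfc f (π d) := fun d hd hdJ =>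
      StarAlgHomClass.map_cfc (S := ℂ) π f d (hf.1.mono (hdJ.trans hmM)) hπ hd (hd.map π)
    have hspec : ∀ d : A, spectrum ℝ (π d) ⊆ spectrum ℝ d := fun d =>
      AlgHom.spectrum_apply_subset (π.restrictScalars ℝ) d
    have hsmul : ∀ (r : ℝ) (d : A), π (r • d) = r • π d := fun r d =>
      map_smul (π.restrictScalars ℝ) r d
    rw [map_sub, sub_nonneg, hmap _ hab (spectrum_convexCombination_subset ha hb haJ hbJ hc),
      map_add, map_add, hsmul, hsmul, hsmul, hsmul, hmap a ha haJ, hmap b hb hbJ]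
    exact hf.2 φ.GNS (π a) (π b) (ha.map π) (hb.map π)
      ((hspec a).trans (haJ.trans hmM)) ((hspec b).trans (hbJ.trans hmM)) c hc

/-- If two continuous linear maps agree on the powers of `a` and `b`, then they agree on the
continuous functional calculi of `a` and `b`. -/
theorem map_cfc_eq_map_cfc_of_forall_pow {B₁ : Type u} {B₂ : Type v} {V : Type w} [CStarAlgebra B₁]
    [CStarAlgebra B₂] [NormedAddCommGroup V] [NormedSpace ℝ V] (Φ : B₁ →L[ℝ] V) (Ψ : B₂ →L[ℝ] V)
    {a : B₁} {b : B₂} (ha : IsSelfAdjoint a) (hb : IsSelfAdjoint b)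
    (h : ∀ n : ℕ, Φ (a ^ n) = Ψ (b ^ n)) {f : ℝ → ℝ} {s : Set ℝ} (hs : IsCompact s)
    (hf : ContinuousOn f s) (has : spectrum ℝ a ⊆ s) (hbs : spectrum ℝ b ⊆ s) :
    Φ (cfc f a) = Ψ (cfc f b) := by
  have : CompactSpace s := isCompact_iff_compactSpace.mp hs
  have hd : ∀ g : C(s, ℝ), Φ (cfcHomSuperset ha has g) = Ψ (cfcHomSuperset hb hbs g) := by
    intro g
    have hcl : IsClosed {g : C(s, ℝ) | Φ (cfcHomSuperset ha has g) = Ψ (cfcHomSuperset hb hbs g)} :=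
      isClosed_eq (Φ.continuous.comp (cfcHomSuperset_continuous ha has))
        (Ψ.continuous.comp (cfcHomSuperset_continuous hb hbs))
    -- By Weierstrass it suffices to treat polynomials, where linearity reduces to powers; neither
    -- map need be multiplicative.
    have hg : g ∈ (polynomialFunctions s).topologicalClosure := by
      rw [ContinuousMap.subalgebra_topologicalClosure_eq_top_of_separatesPoints _
        (polynomialFunctions_separatesPoints s)]
      trivial
    refine closure_minimal ?_ hcl hg
    rintro _ ⟨p, -, rfl⟩
    have hX : Polynomial.toContinuousMapOnAlgHom s Polynomial.X
        = ContinuousMap.restrict s (ContinuousMap.id ℝ) := by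
      ext x
      simp
    change Φ (((cfcHomSuperset ha has : C(s, ℝ) →ₐ[ℝ] B₁).comp
      (Polynomial.toContinuousMapOnAlgHom s)) p) =
      Ψ (((cfcHomSuperset hb hbs : C(s, ℝ) →ₐ[ℝ] B₂).comp
      (Polynomial.toContinuousMapOnAlgHom s)) p)
    have e1 : ((cfcHomSuperset ha has : C(s, ℝ) →ₐ[ℝ] B₁).comp
      (Polynomial.toContinuousMapOnAlgHom s)) = Polynomial.aeval a := by
      refine Polynomial.algHom_ext ?_
      simp only [AlgHom.comp_apply, Polynomial.aeval_X, hX]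
      exact cfcHomSuperset_id ha has
    have e2 : ((cfcHomSuperset hb hbs : C(s, ℝ) →ₐ[ℝ] B₂).comp
      (Polynomial.toContinuousMapOnAlgHom s)) = Polynomial.aeval b := by
      refine Polynomial.algHom_ext ?_
      simp only [AlgHom.comp_apply, Polynomial.aeval_X, hX]
      exact cfcHomSuperset_id hb hbs
    rw [e1, e2, Polynomial.aeval_eq_sum_range, Polynomial.aeval_eq_sum_range]
    simp [h]
  have := hd ⟨s.domRestrict f, hf.domRestrict⟩
  rw [cfc_apply f a ha (hf.mono has), cfc_apply f b hb (hf.mono hbs)]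
  exact this

/-- The continuous functional calculus commutes with conjugation by a self-adjoint unitary. -/
theorem cfc_conj_of_mul_self_eq_one {A : Type u} [CStarAlgebra A] {a U : A}
    (ha : IsSelfAdjoint a) (hU : IsSelfAdjoint U) (hUU : U * U = 1) {f : ℝ → ℝ}
    (hf : ContinuousOn f (spectrum ℝ a)) :
    spectrum ℝ (U * a * U) = spectrum ℝ a ∧ cfc f (U * a * U) = U * cfc f a * U := by
  let UU : unitary A := ⟨U, by rw [Unitary.mem_iff, hU.star_eq]; exact ⟨hUU, hUU⟩⟩
  have hspec : spectrum ℝ (U * a * U) = spectrum ℝ a := by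
    have h1 := Unitary.spectrum_star_right_conjugate (R := ℝ) (a := a) (U := UU)
    simpa [UU, hU.star_eq] using h1
  have ha' : IsSelfAdjoint (U * a * U) := by
    have := ha.conjugate U
    rwa [hU.star_eq] at this
  have hpow : ∀ n : ℕ, (U * a * U) ^ n = U * a ^ n * U := by
    intro n
    induction n with
    | zero => simp [hUU]
    | succ n ih =>
      calc (U * a * U) ^ (n + 1) = U * a ^ n * (U * U) * a * U := by
            rw [pow_succ, ih]; simp only [mul_assoc]
        _ = U * a ^ (n + 1) * U := by rw [hUU, mul_one, pow_succ, mul_assoc U]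
  refine ⟨hspec, ?_⟩
  exact map_cfc_eq_map_cfc_of_forall_pow (ContinuousLinearMap.id ℝ A)
    ((ContinuousLinearMap.mul ℝ A).flip U ∘L (ContinuousLinearMap.mul ℝ A U)) ha' ha
    (fun n => by simp [hpow]) (ContinuousFunctionalCalculus.isCompact_spectrum a) hf
    hspec.subset le_rfl

end CStarAlgebra

namespace HilbertModule

open scoped WithCStarModule

/-! ### Compressions by a unit vector. -/

section

variable {A : Type u} {X : Type v} [CStarAlgebra A] [PartialOrder A] [StarOrderedRing A]
  [NormedAddCommGroup X] [NormedSpace ℂ X] [Module Aᵐᵒᵖ X] [CStarModule Aᵐᵒᵖ X]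

theorem ip_sub_right (x y z : X) : ip A x (y - z) = ip A x y - ip A x z := by
  simp [ip]

theorem ip_sum_right {ι : Type*} (s : Finset ι) (x : X) (y : ι → X) :
    ip A x (∑ i ∈ s, y i) = ∑ i ∈ s, ip A x (y i) :=
  map_sum (AddMonoidHom.mk' (ip A x) (ip_add_right A x)) y s

theorem ip_real_smul_right (r : ℝ) (x y : X) : ip A x (r • y) = r • ip A x y :=
  ip_smul_right A (r : ℂ) x y

theorem ip_real_smul_left (r : ℝ) (x y : X) : ip A (r • x) y = r • ip A x y := by
  rw [← star_ip, ip_real_smul_right, star_smul, star_ip]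
  simp

theorem ip_op_smul_left (x y : X) (a : A) : ip A (op a • x) y = star a * ip A x y := by
  rw [← star_ip, ip_mul_right, star_mul, star_ip]

/-- The mapping `y ↦ ⟨x, y⟩` as a bounded operator. -/
def ipL (x : X) : X →L[ℝ] A where
  toFun := ip A x
  map_add' := ip_add_right A x
  map_smul' r y := ip_real_smul_right r x y
  cont := (continuous_ip A).comp (continuous_const.prodMk continuous_id)

/-- The evaluation `T ↦ T x` as a bounded operator on `𝓛(X)`. -/
def Adjointable.evalL (x : X) : Adjointable A X →L[ℝ] X where
  toFun T := T x
  map_add' _ _ := rfl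
  map_smul' _ _ := rfl
  cont := ((ContinuousLinearMap.apply ℂ X x).continuous).comp continuous_subtype_val

theorem Adjointable.mul_apply (T S : Adjointable A X) (x : X) : (T * S) x = T (S x) := rfl

theorem Adjointable.add_apply (T S : Adjointable A X) (x : X) : (T + S) x = T x + S x := rfl

theorem Adjointable.real_smul_apply (r : ℝ) (T : Adjointable A X) (x : X) :
    (r • T) x = r • T x := rfl

theorem Adjointable.map_op_smul [CompleteSpace X] (T : Adjointable A X) (a : A) (x : X) :
    T (op a • x) = op a • T x :=
  ext_ip A fun z => by
    rw [← T.ip_apply_left.symm, ip_mul_right, ip_mul_right, ← T.ip_apply_left.symm]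

theorem Adjointable.star_apply_of_isSelfAdjoint [CompleteSpace X] {T : Adjointable A X}
    (hT : IsSelfAdjoint T) (x y : X) : ip A (T x) y = ip A x (T y) := by
  have h := T.ip_apply_left x y
  rwa [hT.star_eq] at h

theorem Adjointable.isSelfAdjoint_of_ip [CompleteSpace X] {T : Adjointable A X}
    (h : ∀ x y, ip A (T x) y = ip A x (T y)) : IsSelfAdjoint T :=
  Adjointable.star_eq h

section Order

variable [CompleteSpace X] [PartialOrder (Adjointable A X)] [StarOrderedRing (Adjointable A X)]

theorem Adjointable.ip_apply_nonneg {T : Adjointable A X} (hT : 0 ≤ T) (x : X) :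
    0 ≤ ip A x (T x) := by
  obtain ⟨S, rfl⟩ := CStarAlgebra.nonneg_iff_eq_star_mul_self.mp hT
  have h : ip A (S x) (S x) = ip A x ((star S * S) x) := S.ip_apply_left x (S x)
  rw [← h]
  exact ip_self_nonneg A _

theorem Adjointable.ip_apply_mono {T S : Adjointable A X} (h : T ≤ S) (x : X) :
    ip A x (T x) ≤ ip A x (S x) := by
  have h1 := Adjointable.ip_apply_nonneg (sub_nonneg.mpr h) x
  change 0 ≤ ip A x (S x - T x) at h1
  rwa [ip_sub_right, sub_nonneg] at h1

end Order

/-- The spectrum of a compression `⟨x, T x⟩` by a unit vector lies in every interval that contains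
the spectrum of `T`. -/
theorem Adjointable.spectrum_ip_apply_subset [CompleteSpace X] {T : Adjointable A X}
    (hT : IsSelfAdjoint T) {m M : ℝ} (h : spectrum ℝ T ⊆ Set.Icc m M) {x : X}
    (hx : ip A x x = 1) : spectrum ℝ (ip A x (T x)) ⊆ Set.Icc m M := by
  let _ := CStarAlgebra.spectralOrder (Adjointable A X)
  have _ := CStarAlgebra.spectralOrderedRing (Adjointable A X)
  have hsa : IsSelfAdjoint (ip A x (T x)) := by
    rw [isSelfAdjoint_iff, star_ip, star_apply_of_isSelfAdjoint hT]
  -- Since `⟨x, x⟩ = 1`, the compression preserves scalars; being monotone, it preserves the bounds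
  -- `m` and `M`.
  have key : ∀ r : ℝ, ip A x (algebraMap ℝ (Adjointable A X) r x) = algebraMap ℝ A r := by
    intro r
    rw [Algebra.algebraMap_eq_smul_one, Algebra.algebraMap_eq_smul_one, ← hx]
    exact ip_real_smul_right r x x
  have h1 : algebraMap ℝ A m ≤ ip A x (T x) := by
    rw [← key]
    exact ip_apply_mono ((algebraMap_le_iff_le_spectrum hT).mpr fun y hy => (h hy).1) x
  have h2 : ip A x (T x) ≤ algebraMap ℝ A M := by
    rw [← key]
    exact ip_apply_mono ((le_algebraMap_iff_spectrum_le hT).mpr fun y hy => (h hy).2) x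
  exact fun y hy => ⟨(algebraMap_le_iff_le_spectrum hsa).mp h1 y hy,
    (le_algebraMap_iff_spectrum_le hsa).mp h2 y hy⟩

/-- The symmetry `2 x⟨x, ·⟩ - 1` about a unit vector `x`. -/
theorem Adjointable.exists_symmetry [CompleteSpace X] {x : X} (hx : ip A x x = 1) :
    ∃ U : Adjointable A X, IsSelfAdjoint U ∧ U * U = 1 ∧
      ∀ y, U y = (2 : ℂ) • (op (ip A x y) • x) - y := by
  let u : X → X := fun y => (2 : ℂ) • (op (ip A x y) • x) - y
  have hu : IsAdjointPair A u u := by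
    intro y z
    have e1 : ip A (u y) z + ip A y z = (2 : ℂ) • (ip A y x * ip A x z) := by
      rw [← ip_add_left, sub_add_cancel, ip_smul_left, ip_op_smul_left, star_ip]
      simp
    have e2 : ip A y (u z) + ip A y z = (2 : ℂ) • (ip A y x * ip A x z) := by
      rw [← ip_add_right, sub_add_cancel, ip_smul_right, ip_mul_right]
    exact add_right_cancel (e1.trans e2.symm)
  obtain ⟨U', hU'⟩ := hu.exists_clm
  let U : Adjointable A X := ⟨U', u, by rw [hU']; exact hu⟩
  have hU : ∀ y, U y = u y := fun y => congrFun hU' y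
  refine ⟨U, isSelfAdjoint_of_ip fun y z => ?_, ?_, hU⟩
  · rw [hU, hU, hu]
  · refine Subtype.ext (ContinuousLinearMap.ext fun y => ?_)
    change U (U y) = y
    -- The reflection keeps the component along `x`, so `u (u y) = 2 x⟨x, y⟩ - u y = y`.
    have h : ip A x (u y) = ip A x y := by
      refine add_right_cancel (b := ip A x y) ?_
      rw [← ip_add_right, sub_add_cancel, ip_smul_right, ip_mul_right, hx, one_mul, two_smul]
    rw [hU, hU]
    change (2 : ℂ) • (op (ip A x (u y)) • x) - u y = y
    rw [h]
    exact sub_sub_cancel _ _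

/-- Jensen's operator inequality for the compression by a unit vector. -/
theorem Adjointable.cfc_ip_apply_le_of_ip_self_eq_one [CompleteSpace X] {J : Set ℝ} {f : ℝ → ℝ}
    (hf : OperatorConvexOn.{v} J f) {T : Adjointable A X} (hT : IsSelfAdjoint T) {m M : ℝ}
    (hmM : Set.Icc m M ⊆ J) (h : spectrum ℝ T ⊆ Set.Icc m M) {x : X} (hx : ip A x x = 1) :
    cfc f (ip A x (T x)) ≤ ip A x (cfc f T x) := by
  let _ := CStarAlgebra.spectralOrder (Adjointable A X)
  have _ := CStarAlgebra.spectralOrderedRing (Adjointable A X)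
  obtain ⟨U, hU, hUU, hUx⟩ := exists_symmetry hx
  have hUfix : U x = x := by
    rw [hUx, hx, op_one, one_smul, two_smul, add_sub_cancel_right]
  let T' : Adjointable A X := U * T * U
  have hT' : IsSelfAdjoint T' := by
    have := hT.conjugate U
    rwa [hU.star_eq] at this
  obtain ⟨hspecT, hcfc'⟩ := cfc_conj_of_mul_self_eq_one hT hU hUU (hf.1.mono (h.trans hmM))
  have hspec' : spectrum ℝ T' ⊆ Set.Icc m M := hspecT.trans_subset h
  have hc : (1 / 2 : ℝ) ∈ Set.Icc (0 : ℝ) 1 := by norm_num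
  have hB := hf.cfc_convexCombination_le hT hT' hmM h hspec' hc
  set B := (1 - 1 / 2 : ℝ) • T + (1 / 2 : ℝ) • T' with hBdef
  have hBsa : IsSelfAdjoint B :=
    ((IsSelfAdjoint.all _).smul hT).add ((IsSelfAdjoint.all _).smul hT')
  have hBspec : spectrum ℝ B ⊆ Set.Icc m M := spectrum_convexCombination_subset hT hT' h hspec' hc
  set a := ip A x (T x) with ha
  have hasa : IsSelfAdjoint a := by
    rw [isSelfAdjoint_iff, star_ip, star_apply_of_isSelfAdjoint hT]
  -- As `U x = x`, averaging `T x` with `U T x = 2 x a - T x` leaves `x a`.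
  have hBx : B x = op a • x := by
    rw [hBdef, add_apply, real_smul_apply, real_smul_apply, mul_apply, mul_apply, hUfix, hUx,
      ← ha, smul_sub, show ((2 : ℂ) • (op a • x)) = (2 : ℝ) • (op a • x) by
      rw [two_smul, two_smul], smul_smul]
    norm_num
  have hpow : ∀ n : ℕ, (B ^ n) x = op (a ^ n) • x := by
    intro n
    induction n with
    | zero => rw [pow_zero, pow_zero, op_one, one_smul]; rfl
    | succ n ih =>
      rw [pow_succ', mul_apply, ih, map_op_smul, hBx, smul_smul, pow_succ', op_mul]
  have hfB : ip A x (cfc f B x) = cfc f a := by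
    refine map_cfc_eq_map_cfc_of_forall_pow ((ipL x).comp (evalL x)) (ContinuousLinearMap.id ℝ A)
      hBsa hasa (fun n => ?_) isCompact_Icc (hf.1.mono hmM) hBspec (spectrum_ip_apply_subset hT h hx)
    change ip A x ((B ^ n) x) = a ^ n
    rw [hpow, ip_mul_right, hx, one_mul]
  have h1 := ip_apply_mono hB x
  rw [hfB, hcfc'] at h1
  -- Both halves of the right side have the same compression, because `U` is self-adjoint and fixes
  -- `x`.
  refine h1.trans (le_of_eq ?_)
  rw [add_apply, real_smul_apply, real_smul_apply, mul_apply, mul_apply, ip_add_right,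
    ip_real_smul_right, ip_real_smul_right, ← star_apply_of_isSelfAdjoint hU,
    hUfix, ← add_smul]
  norm_num

end
-- Intertwiners and the functional calculus.
section Intertwining

variable {A : Type u} {E : Type v} [CStarAlgebra A] [PartialOrder A] [StarOrderedRing A]
  [NormedAddCommGroup E] [NormedSpace ℂ E] [Module Aᵐᵒᵖ E] [CStarModule Aᵐᵒᵖ E] [CompleteSpace E]

/-- A bounded operator intertwining `T` and `S` intertwines `f(T)` and `f(S)`. -/
theorem Adjointable.map_cfc_apply {X : Type w} [NormedAddCommGroup X] [NormedSpace ℂ X]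
    [Module Aᵐᵒᵖ X] [CStarModule Aᵐᵒᵖ X] [CompleteSpace X] {T : Adjointable A E}
    {S : Adjointable A X} (hT : IsSelfAdjoint T) (hS : IsSelfAdjoint S) {f : ℝ → ℝ} {s : Set ℝ}
    (hs : IsCompact s) (hf : ContinuousOn f s) (hTs : spectrum ℝ T ⊆ s) (hSs : spectrum ℝ S ⊆ s)
    (V : E →L[ℂ] X) (hV : ∀ z, V (T z) = S (V z)) (z : E) :
    V (cfc f T z) = cfc f S (V z) := by
  have hpow : ∀ n : ℕ, V ((T ^ n) z) = (S ^ n) (V z) := by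
    intro n
    induction n with
    | zero => rfl
    | succ n ih => rw [pow_succ', pow_succ', mul_apply, mul_apply, hV, ih]
  exact map_cfc_eq_map_cfc_of_forall_pow ((V.restrictScalars ℝ).comp (evalL z)) (evalL (V z))
    hT hS hpow hs hf hTs hSs

/-- A bounded operator intertwining `T` and the scalar `r` intertwines `f(T)` and `f r`. -/
theorem Adjointable.map_cfc_apply_of_smul {X : Type w} [NormedAddCommGroup X] [NormedSpace ℂ X]
    {T : Adjointable A E} (hT : IsSelfAdjoint T) {f : ℝ → ℝ} {s : Set ℝ} (hs : IsCompact s)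
    (hf : ContinuousOn f s) (hTs : spectrum ℝ T ⊆ s) {r : ℝ} (hr : r ∈ s) (V : E →L[ℂ] X)
    (hV : ∀ z, V (T z) = (r : ℂ) • V z) (z : E) :
    V (cfc f T z) = (f r : ℂ) • V z := by
  have hpow : ∀ n : ℕ, V ((T ^ n) z) = (r : ℂ) ^ n • V z := by
    intro n
    induction n with
    | zero => rw [pow_zero, pow_zero, one_smul]; rfl
    | succ n ih => rw [pow_succ', pow_succ', mul_apply, hV, ih, smul_smul]
  have hspec : spectrum ℝ (algebraMap ℝ ℂ r) ⊆ s := by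
    rw [spectrum.scalar_eq]
    exact Set.singleton_subset_iff.mpr hr
  -- The scalar `r` is an element of the C⋆-algebra `ℂ`, mapped to the target by `c ↦ c • V z`.
  have h := map_cfc_eq_map_cfc_of_forall_pow (b := algebraMap ℝ ℂ r) (f := f)
    ((V.restrictScalars ℝ).comp (evalL z))
    ((ContinuousLinearMap.toSpanSingleton ℂ (V z)).restrictScalars ℝ) hT
    ((IsSelfAdjoint.all r).algebraMap ℂ) hpow hs hf hTs hspec
  rw [cfc_algebraMap] at h
  exact h

end Intertwining

/-! ### From unit vectors to column contractions. -/

section DirectSum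

variable (A : Type u) (X : Type v) [CStarAlgebra A] [PartialOrder A] [StarOrderedRing A]
  [NormedAddCommGroup X] [NormedSpace ℂ X] [Module Aᵐᵒᵖ X] [CStarModule Aᵐᵒᵖ X]
  (ι : Type) [Fintype ι]

/-- The right Hilbert module `A ⊕ X^ι`. -/
abbrev DirectSum : Type max u v := C⋆ᵐᵒᵈ(Aᵐᵒᵖ, Aᵐᵒᵖ × C⋆ᵐᵒᵈ(Aᵐᵒᵖ, ι → X))

variable {A X ι}

/-- The vector of `A ⊕ X^ι` with the given components. -/
def DirectSum.mk (a : A) (y : ι → X) : DirectSum A X ι := (op a, y)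

/-- The component in `A`, as a bounded operator. -/
noncomputable def DirectSum.fstL : DirectSum A X ι →L[ℂ] Aᵐᵒᵖ :=
  (ContinuousLinearMap.fst ℂ Aᵐᵒᵖ C⋆ᵐᵒᵈ(Aᵐᵒᵖ, ι → X)).comp
    (WithCStarModule.equivL (A := Aᵐᵒᵖ) ℂ).toContinuousLinearMap

/-- The component in the `i`-th copy of `X`, as a bounded operator. -/
noncomputable def DirectSum.sndL (i : ι) : DirectSum A X ι →L[ℂ] X :=
  (ContinuousLinearMap.proj (R := ℂ) (φ := fun _ : ι => X) i).comp
    ((WithCStarModule.equivL (A := Aᵐᵒᵖ) ℂ).toContinuousLinearMap.comp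
      ((ContinuousLinearMap.snd ℂ Aᵐᵒᵖ C⋆ᵐᵒᵈ(Aᵐᵒᵖ, ι → X)).comp
        (WithCStarModule.equivL (A := Aᵐᵒᵖ) ℂ).toContinuousLinearMap))

theorem DirectSum.ext {z z' : DirectSum A X ι} (h : fstL z = fstL z')
    (h' : ∀ i, sndL i z = sndL i z') : z = z' :=
  Prod.ext h (funext h')

theorem DirectSum.ip_eq (z z' : DirectSum A X ι) :
    ip A z z' = star (unop (fstL z)) * unop (fstL z') + ∑ i, ip A (sndL i z) (sndL i z') := by
  change unop (_ + _) = _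
  rw [unop_add]
  congr 1
  change unop (∑ i, _) = _
  rw [Finset.unop_sum]
  rfl

variable [CompleteSpace X]

/-- The diagonal operators on `A ⊕ X^ι` with a scalar as first entry. -/
theorem DirectSum.exists_diagonal :
    ∃ π : (ℂ × (ι → Adjointable A X)) →ₐ[ℂ] Adjointable A (DirectSum A X ι),
      (∀ d z, fstL (π d z) = d.1 • fstL z) ∧ ∀ d z i, sndL i (π d z) = d.2 i (sndL i z) := by
  let p (d : ℂ × (ι → Adjointable A X)) (z : DirectSum A X ι) : DirectSum A X ι :=
    mk (unop (d.1 • fstL z)) fun i => d.2 i (sndL i z)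
  have hp : ∀ d, IsAdjointPair A (p d) (p (star d)) := by
    intro d z z'
    rw [ip_eq, ip_eq]
    congr 1
    · change star (d.1 • unop (fstL z)) * unop (fstL z') =
        star (unop (fstL z)) * (star d.1 • unop (fstL z'))
      rw [star_smul, smul_mul_assoc, mul_smul_comm]
    · exact Finset.sum_congr rfl fun i _ => (d.2 i).ip_apply_left _ _
  choose P hP using fun d => (hp d).exists_clm
  let Q (d : ℂ × (ι → Adjointable A X)) : Adjointable A (DirectSum A X ι) :=
    ⟨P d, p (star d), by rw [hP]; exact hp d⟩
  have hQ1 : ∀ d z, fstL (Q d z) = d.1 • fstL z := fun d z =>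
    congrArg (fun q : DirectSum A X ι → DirectSum A X ι => fstL (q z)) (hP d)
  have hQ2 : ∀ d z i, sndL i (Q d z) = d.2 i (sndL i z) := fun d z i =>
    congrArg (fun q : DirectSum A X ι → DirectSum A X ι => sndL i (q z)) (hP d)
  have hext : ∀ T S : Adjointable A (DirectSum A X ι), (∀ z, fstL (T z) = fstL (S z)) →
      (∀ z i, sndL i (T z) = sndL i (S z)) → T = S := fun T S h h' =>
    Subtype.ext (ContinuousLinearMap.ext fun z => DirectSum.ext (h z) (h' z))
  have hsmul : ∀ (c : ℂ) d, Q (c • d) = c • Q d := by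
    intro c d
    refine hext _ _ (fun z => ?_) fun z i => ?_
    · change _ = fstL (c • Q d z)
      rw [map_smul, hQ1, hQ1, Prod.smul_fst, smul_assoc]
    · change _ = sndL i (c • Q d z)
      rw [map_smul, hQ2, hQ2]
      rfl
  have hone : Q 1 = 1 := by
    refine hext _ _ (fun z => ?_) fun z i => ?_
    · rw [hQ1, Prod.fst_one, one_smul]
      rfl
    · rw [hQ2]
      rfl
  refine ⟨AlgHom.ofLinearMap
    { toFun := Q
      map_add' := fun d d' => hext _ _ (fun z => ?_) fun z i => ?_
      map_smul' := hsmul } hone fun d d' => hext _ _ (fun z => ?_) fun z i => ?_, hQ1, hQ2⟩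
  · rw [Adjointable.add_apply, map_add, hQ1, hQ1, hQ1, Prod.fst_add, add_smul]
  · rw [Adjointable.add_apply, map_add, hQ2, hQ2, hQ2]
    rfl
  · change fstL (Q (d * d') z) = fstL (Q d (Q d' z))
    rw [hQ1, hQ1, hQ1, Prod.fst_mul, mul_smul]
  · change sndL i (Q (d * d') z) = sndL i (Q d (Q d' z))
    rw [hQ2, hQ2, hQ2]
    rfl

/-- Jensen's operator inequality for column contractions: the compression is
`∑ i, ⟨y i, T i (y i)⟩` with `∑ i, ⟨y i, y i⟩ ≤ 1`. -/
theorem Adjointable.cfc_sum_ip_apply_le {J : Set ℝ} {f : ℝ → ℝ}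
    (hf : OperatorConvexOn.{max u v} J f) (hf0 : f 0 ≤ 0) {m M : ℝ} (hmM : Set.Icc m M ⊆ J)
    (h0 : (0 : ℝ) ∈ Set.Icc m M) {T : ι → Adjointable A X} (hT : ∀ i, IsSelfAdjoint (T i))
    (hspec : ∀ i, spectrum ℝ (T i) ⊆ Set.Icc m M) {y : ι → X} (hy : ∑ i, ip A (y i) (y i) ≤ 1) :
    spectrum ℝ (∑ i, ip A (y i) (T i (y i))) ⊆ Set.Icc m M ∧
      cfc f (∑ i, ip A (y i) (T i (y i))) ≤ ∑ i, ip A (y i) (cfc f (T i) (y i)) := by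
  obtain ⟨π, hπ1, hπ2⟩ := DirectSum.exists_diagonal (A := A) (X := X) (ι := ι)
  -- The square root of the defect is the `A`-coordinate that makes `(s, y)` a unit vector.
  set s : A := CFC.sqrt (1 - ∑ i, ip A (y i) (y i)) with hs
  have hss : star s * s = 1 - ∑ i, ip A (y i) (y i) := by
    rw [(CFC.sqrt_nonneg _).isSelfAdjoint.star_eq]
    exact CFC.sqrt_mul_sqrt_self _ (sub_nonneg.mpr hy)
  let z : DirectSum A X ι := DirectSum.mk s y
  have hz1 : DirectSum.fstL z = op s := rfl
  have hz2 : ∀ i, DirectSum.sndL i z = y i := fun _ => rfl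
  have hz : ip A z z = 1 := by
    rw [DirectSum.ip_eq, hz1, unop_op, hss]
    simp only [hz2]
    exact sub_add_cancel _ _
  let d : ℂ × (ι → Adjointable A X) := (((0 : ℝ) : ℂ), T)
  have hD : IsSelfAdjoint (π d) := by
    refine isSelfAdjoint_of_ip fun z z' => ?_
    rw [DirectSum.ip_eq, DirectSum.ip_eq]
    simp only [hπ1, hπ2, d, Complex.ofReal_zero, zero_smul, unop_zero, star_zero,
      zero_mul, mul_zero, zero_add]
    exact Finset.sum_congr rfl fun i _ => star_apply_of_isSelfAdjoint (hT i) _ _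
  have hDspec : spectrum ℝ (π d) ⊆ Set.Icc m M := by
    -- Algebra homomorphisms do not enlarge spectra, and the spectrum of `d` in the product is the
    -- union of those of its entries.
    refine (AlgHom.spectrum_apply_subset (π.restrictScalars ℝ) d).trans ?_
    rw [Prod.spectrum_eq, Pi.spectrum_eq, Complex.ofReal_zero]
    refine Set.union_subset ?_ (Set.iUnion_subset hspec)
    rw [spectrum.zero_eq]
    exact Set.singleton_subset_iff.mpr h0
  have hcont : ContinuousOn f (Set.Icc m M) := hf.1.mono hmM
  have hfD1 : DirectSum.fstL (cfc f (π d) z) = (f 0 : ℂ) • op s :=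
    map_cfc_apply_of_smul hD isCompact_Icc hcont hDspec h0 DirectSum.fstL (hπ1 d) z
  have hfD2 : ∀ i, DirectSum.sndL i (cfc f (π d) z) = cfc f (T i) (y i) := fun i =>
    map_cfc_apply hD (hT i) isCompact_Icc hcont hDspec (hspec i) (DirectSum.sndL i)
      (fun z => hπ2 d z i) z
  have hDz : ip A z (π d z) = ∑ i, ip A (y i) (T i (y i)) := by
    rw [DirectSum.ip_eq]
    simp only [hπ1, hπ2, hz2, d, Complex.ofReal_zero, zero_smul, unop_zero, mul_zero, zero_add]
  have hfDz : ip A z (cfc f (π d) z) =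
      f 0 • (star s * s) + ∑ i, ip A (y i) (cfc f (T i) (y i)) := by
    rw [DirectSum.ip_eq, hfD1, hz1, unop_smul, unop_op, mul_smul_comm]
    simp only [hfD2, hz2]
    rfl
  rw [← hDz]
  refine ⟨spectrum_ip_apply_subset hD hDspec hz, ?_⟩
  refine (cfc_ip_apply_le_of_ip_self_eq_one hf hD hmM hDspec hz).trans ?_
  rw [hfDz]
  -- The contribution `f 0 • (star s * s)` of the extra coordinate is dropped.
  exact add_le_of_nonpos_left (smul_nonpos_of_nonpos_of_nonneg hf0 (star_mul_self_nonneg s))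

end DirectSum

/-! ### Compact subintervals and the main inequality. -/

/-- Finitely many spectra contained in an interval around `0` are contained in a compact
subinterval around `0`. -/
theorem exists_Icc_of_spectrum_subset {B : Type u} [CStarAlgebra B] {ι : Type v} [Finite ι]
    {J : Set ℝ} (hJ : J.OrdConnected) (h0J : (0 : ℝ) ∈ J) {T : ι → B}
    (hT : ∀ i, spectrum ℝ (T i) ⊆ J) :
    ∃ m M : ℝ, Set.Icc m M ⊆ J ∧ (0 : ℝ) ∈ Set.Icc m M ∧ ∀ i, spectrum ℝ (T i) ⊆ Set.Icc m M := by
  -- Compactness puts the infimum and supremum in `K ⊆ J`; including `0` keeps `K` nonempty.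
  let K : Set ℝ := insert 0 (⋃ i, spectrum ℝ (T i))
  have hK : IsCompact K :=
    (isCompact_iUnion fun i => ContinuousFunctionalCalculus.isCompact_spectrum (T i)).insert 0
  have hKJ : K ⊆ J := Set.insert_subset h0J (Set.iUnion_subset hT)
  have h0K : (0 : ℝ) ∈ K := Set.mem_insert _ _
  have hKI : K ⊆ Set.Icc (sInf K) (sSup K) := fun x hx =>
    ⟨csInf_le hK.bddBelow hx, le_csSup hK.bddAbove hx⟩
  exact ⟨sInf K, sSup K, hJ.out (hKJ (hK.sInf_mem ⟨0, h0K⟩)) (hKJ (hK.sSup_mem ⟨0, h0K⟩)), hKI h0K,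
    fun i => (Set.subset_iUnion (fun i => spectrum ℝ (T i)) i).trans
      ((Set.subset_insert _ _).trans hKI)⟩

end HilbertModule

-- The universe `max u v` is that of `DirectSum A X ι`, hence of the GNS spaces of its operator
-- algebra, where convexity is applied.
open HilbertModule in
theorem mainTheorem5
    {A : Type u} [CStarAlgebra A] [PartialOrder A] [StarOrderedRing A]
    {X : Type v} [NormedAddCommGroup X] [NormedSpace ℂ X] [CompleteSpace X]
    [Module Aᵐᵒᵖ X] [CStarModule Aᵐᵒᵖ X]
    {J : Set ℝ} (hJ : J.OrdConnected) (h0J : (0 : ℝ) ∈ J)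
    {f : ℝ → ℝ} (hf : OperatorConvexOn.{max u v} J f) (hf0 : f 0 ≤ 0)
    {n : ℕ} (S : HilbertModule.Adjointable A X) (R T : Fin n → HilbertModule.Adjointable A X)
    (hS : IsSelfAdjoint S) (hT : ∀ i, IsSelfAdjoint (T i))
    (hSJ : spectrum ℝ (S - ∑ i, star (R i) * T i * R i) ⊆ J)
    (hTJ : ∀ i, spectrum ℝ (T i) ⊆ J)
    (x : X) (hx : ‖x‖ ≤ 1)
    (k : ℝ) (hk : k = (1 + ∑ i, ‖R i x‖ ^ 2)⁻¹) :
    spectrum ℝ (k • HilbertModule.ip A x (S x)) ⊆ J ∧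
      k⁻¹ • cfc f (k • HilbertModule.ip A x (S x)) ≤
        HilbertModule.ip A x
          ((cfc f (S - ∑ i, star (R i) * T i * R i) + ∑ i, star (R i) * cfc f (T i) * R i) x) := by
  have hsum : 0 ≤ ∑ i, ‖R i x‖ ^ 2 := Finset.sum_nonneg fun i _ => sq_nonneg _
  have hk0 : 0 < k := by rw [hk]; positivity
  have hk1 : k * (1 + ∑ i, ‖R i x‖ ^ 2) = 1 := by rw [hk]; exact inv_mul_cancel₀ (by positivity)
  -- The index `none` carries the entry with `S`, and `some i` the entry `T i`.
  let D : Option (Fin n) → Adjointable A X := fun o =>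
    o.elim (S - ∑ i, star (R i) * T i * R i) T
  let y : Option (Fin n) → X := fun o => o.elim x fun i => R i x
  let y' : Option (Fin n) → X := fun o => √k • y o
  have hD : ∀ o, IsSelfAdjoint (D o) := by
    rintro (_ | i)
    · exact hS.sub (isSelfAdjoint_sum _ fun i _ => (hT i).conjugate' (R i))
    · exact hT i
  have hDJ : ∀ o, spectrum ℝ (D o) ⊆ J := by
    rintro (_ | i)
    · exact hSJ
    · exact hTJ i
  obtain ⟨m, M, hmM, h0, hspec⟩ := exists_Icc_of_spectrum_subset hJ h0J hDJ
  -- Used for `D`, for `f(D)`, and for `1`, which gives `⟨y', y'⟩`.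
  have hscale : ∀ W : Option (Fin n) → Adjointable A X,
      ∑ o, ip A (y' o) (W o (y' o)) = k • ∑ o, ip A (y o) (W o (y o)) := by
    intro W
    rw [Finset.smul_sum]
    refine Finset.sum_congr rfl fun o _ => ?_
    have h1 : W o (√k • y o) = √k • W o (y o) :=
      ((W o : X →L[ℂ] X).restrictScalars ℝ).map_smul _ _
    rw [h1, ip_real_smul_right, ip_real_smul_left, smul_smul, Real.mul_self_sqrt hk0.le]
  have hconj : ∀ V : Fin n → Adjointable A X,
      ip A x ((∑ i, star (R i) * V i * R i) x) = ∑ i, ip A (R i x) (V i (R i x)) := by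
    intro V
    have h1 : (∑ i, star (R i) * V i * R i) x = ∑ i, (star (R i) * V i * R i) x :=
      map_sum (Adjointable.evalL (A := A) x) _ _
    rw [h1, ip_sum_right]
    exact Finset.sum_congr rfl fun i _ => ((R i).ip_apply_left x _).symm
  have hcomp : ∑ o, ip A (y o) (D o (y o)) = ip A x (S x) := by
    rw [Fintype.sum_option]
    change ip A x (S x - (∑ i, star (R i) * T i * R i) x) + ∑ i, ip A (R i x) (T i (R i x)) = _
    rw [ip_sub_right, hconj, sub_add_cancel]
  have hnorm : ∑ o, ip A (y' o) (y' o) ≤ 1 := by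
    have h1 := hscale 1
    change ∑ o, ip A (y' o) (y' o) = k • ∑ o, ip A (y o) (y o) at h1
    have hle : ∀ u : X, ip A u u ≤ algebraMap ℝ A (‖u‖ ^ 2) := by
      intro u
      rw [norm_sq_eq A]
      exact (ip_self_nonneg A u).isSelfAdjoint.le_algebraMap_norm_self
    have h2 : ∑ o, ip A (y o) (y o) ≤ algebraMap ℝ A (1 + ∑ i, ‖R i x‖ ^ 2) := by
      rw [Fintype.sum_option, map_add, map_sum]
      refine add_le_add ((hle x).trans ?_) (Finset.sum_le_sum fun i _ => hle (R i x))
      exact algebraMap_mono A (pow_le_one₀ (norm_nonneg x) hx)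
    rw [h1]
    refine (smul_le_smul_of_nonneg_left h2 hk0.le).trans (le_of_eq ?_)
    rw [Algebra.smul_def, ← map_mul, hk1, map_one]
  have hjensen := Adjointable.cfc_sum_ip_apply_le hf hf0 hmM h0 hD hspec hnorm
  rw [hscale D, hscale fun o => cfc f (D o), hcomp] at hjensen
  refine ⟨hjensen.1.trans hmM, ?_⟩
  have h1 := smul_le_smul_of_nonneg_left hjensen.2 (inv_nonneg.mpr hk0.le)
  rw [smul_smul k⁻¹ k, inv_mul_cancel₀ hk0.ne', one_smul] at h1
  refine h1.trans (le_of_eq ?_)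
  rw [Adjointable.add_apply, ip_add_right, hconj, Fintype.sum_option]
  rfl
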